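/- Let $X_1,X_2,\dots$ be i.i.d. random variables with values in $[0,\infty)$ and distribution function $F$. Assume that $F$ is continuous and has first and second derivatives $f$ and $f'$ on $[0,\infty)$ (one-sided at $0$) that are continuous and bounded on $[0,\infty)$. Let $$F_n(t)=\frac1n\sum_{i=1}^n \mathbb{I}(X_i\le t)$$ be the empirical distribution function and, for $m,n\in\mathbb{N}$, let $$\hat F^S_{m,n}(x)=\sum_{k=0}^\infty F_n\!\left(\frac km\right)e^{-mx}\frac{(mx)^k}{k!}$$ be the Szasz estimator of $F$. Put $\sigma^2(x)=F(x)(1-F(x))$ and $b^S(x)=\frac{x f'(x)}{2}$. Let $x\in(0,\infty)$ with $0<F(x)<1$, and let $m=m_n\to\infty$ as $n\to\infty$. (a) If $m\,n^{-1/2}\to\infty$, then $n^{1/2}\left(\hat F^S_{m,n}(x)-F(x)\right)\xrightarrow{D}\mathcal N\left(0,\sigma^2(x)\right)$. (b) If $m\,n^{-1/2}\to c$ for a constant $c>0$, then $n^{1/2}\left(\hat F^S_{m,n}(x)-F(x)\right)\xrightarrow{D}\mathcal N\left(c^{-1}b^S(x),\sigma^2(x)\right)$. Here $\xrightarrow{D}$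 denotes convergence in distribution as $n\to\infty$, and $\mathcal N(\mu,\sigma^2)$ is the normal distribution with mean $\mu$ and variance $\sigma^2$. -/

import Mathlib

open MeasureTheory ProbabilityTheory Filter Topology

/-- The empirical distribution function `t ↦ n⁻¹ ∑_{i < n} 𝕀(Xᵢ ≤ t)` of the first `n`
observations, at the outcome `ω`. -/
noncomputable def edf {Ω : Type*} (X : ℕ → Ω → ℝ) (n : ℕ) (ω : Ω) (t : ℝ) : ℝ :=
  (n : ℝ)⁻¹ * ∑ i ∈ Finset.range n, Set.indicator {ω' | X i ω' ≤ t} (fun _ => (1 : ℝ)) ω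

/-- The Poisson weight `V_{k,m}(x) = e^{-mx} (mx)^k / k!`. -/
noncomputable def szaszWeight (k m : ℕ) (x : ℝ) : ℝ :=
  Real.exp (-(m * x)) * ((m * x) ^ k / (k.factorial : ℝ))

/-- The Szasz-Mirakyan operator `S_m(u; x) = ∑_{k ≥ 0} u(k/m) V_{k,m}(x)`. -/
noncomputable def szaszOperator (m : ℕ) (u : ℝ → ℝ) (x : ℝ) : ℝ :=
  ∑' k : ℕ, u (k / m) * szaszWeight k m x

/-- The Szasz estimator: the Szasz-Mirakyan operator applied to the empirical distribution
function of the first `n` observations. -/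
noncomputable def szaszEstimator {Ω : Type*} (X : ℕ → Ω → ℝ) (m n : ℕ) (x : ℝ) (ω : Ω) : ℝ :=
  szaszOperator m (edf X n ω) x

/-! The estimator is an average of `szaszKernel m x (X i)`, so its scaled error splits into three
terms: the normalized sum of the centered indicators of `X i ≤ x`, the normalized centered sum of
the differences `D n` between kernel and indicator, and the deterministic bias `√n (S_m F(x) -
F(x))`. The first obeys the classical central limit theorem. The second vanishes in probability: its
variance is at most `∫ D n ^ 2`, and the kernel tends to the indicator except at `t = x`, which
carries no mass. For the third, `tendsto_mul_szaszOperator_sub` gives `m (S_m F(x) - F(x)) → x f'(x)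
/ 2`, and `√n / m` tends to `0` or to `c⁻¹`. Slutsky's theorem combines them. -/

/-! ### Moments of the Poisson weights -/

lemma hasSum_descFactorial_mul_pow_div_factorial (r : ℕ) (l : ℝ) :
    HasSum (fun k : ℕ => (k.descFactorial r : ℝ) * (l ^ k / k.factorial))
      (l ^ r * Real.exp l) := by
  rw [← hasSum_nat_add_iff' r, Finset.sum_eq_zero, sub_zero]
  · have h : HasSum (fun k : ℕ => l ^ k / (k.factorial : ℝ)) (Real.exp l) := by
      rw [Real.exp_eq_exp_ℝ]
      exact NormedSpace.expSeries_div_hasSum_exp l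
    refine (h.mul_left (l ^ r)).congr_fun fun k => ?_
    have h1 : (k.factorial : ℝ) * ((k + r).descFactorial r : ℝ) = (k + r).factorial := by
      have := Nat.factorial_mul_descFactorial (Nat.le_add_left r k)
      rw [Nat.add_sub_cancel] at this
      exact_mod_cast this
    have h2 : (k.factorial : ℝ) ≠ 0 := by positivity
    have h3 : ((k + r).factorial : ℝ) ≠ 0 := by positivity
    field_simp
    rw [← h1]
    ring
  · intro k hk
    rw [Nat.descFactorial_of_lt (Finset.mem_range.mp hk)]
    simp

/-- Factorial moments of a Poisson law are powers of its mean; the central moments below follow by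
expanding in falling factorials. -/
lemma hasSum_descFactorial_mul_szaszWeight (r m : ℕ) (x : ℝ) :
    HasSum (fun k : ℕ => (k.descFactorial r : ℝ) * szaszWeight k m x) ((m * x) ^ r) := by
  have h := (hasSum_descFactorial_mul_pow_div_factorial r (m * x)).mul_left (Real.exp (-(m * x)))
  have e : Real.exp (-(m * x)) * ((m * x) ^ r * Real.exp (m * x)) = (m * x) ^ r := by
    rw [Real.exp_neg]
    field_simp
  rw [e] at h
  refine h.congr_fun fun k => ?_
  simp only [szaszWeight]
  ring

lemma szaszWeight_nonneg (k m : ℕ) {x : ℝ} (hx : 0 ≤ x) : 0 ≤ szaszWeight k m x := by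
  unfold szaszWeight
  positivity

lemma hasSum_szaszWeight (m : ℕ) (x : ℝ) : HasSum (fun k : ℕ => szaszWeight k m x) 1 := by
  simpa using hasSum_descFactorial_mul_szaszWeight 0 m x

lemma hasSum_szaszWeight_centered {m : ℕ} (hm : m ≠ 0) (x : ℝ) :
    HasSum (fun k : ℕ => ((k : ℝ) / m - x) * szaszWeight k m x) 0 := by
  have hm' : (m : ℝ) ≠ 0 := by exact_mod_cast hm
  have h1 := (hasSum_descFactorial_mul_szaszWeight 1 m x).mul_left ((m : ℝ)⁻¹)
  have h := h1.sub ((hasSum_szaszWeight m x).mul_left x)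
  have e : (m : ℝ)⁻¹ * (m * x) ^ 1 - x * 1 = 0 := by field_simp; ring
  rw [e] at h
  refine h.congr_fun fun k => ?_
  simp only [Nat.descFactorial_one]
  ring

lemma hasSum_szaszWeight_sq {m : ℕ} (hm : m ≠ 0) (x : ℝ) :
    HasSum (fun k : ℕ => ((k : ℝ) / m - x) ^ 2 * szaszWeight k m x) (x / m) := by
  have hm' : (m : ℝ) ≠ 0 := by exact_mod_cast hm
  have d (r) := hasSum_descFactorial_mul_szaszWeight r m x
  have h := (((d 2).add ((d 1).mul_left (1 - 2 * (m * x)))).add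
    ((d 0).mul_left ((m * x) ^ 2))).mul_left (((m : ℝ) ^ 2)⁻¹)
  have e : ((m : ℝ) ^ 2)⁻¹ * ((m * x) ^ 2 + (1 - 2 * (m * x)) * (m * x) ^ 1 +
      (m * x) ^ 2 * (m * x) ^ 0) = x / m := by
    field_simp
    ring
  rw [e] at h
  refine h.congr_fun fun k => ?_
  simp only [← descPochhammer_eval_eq_descFactorial ℝ]
  simp [descPochhammer_succ_right]
  field_simp
  ring

lemma hasSum_szaszWeight_pow_four {m : ℕ} (hm : m ≠ 0) (x : ℝ) :
    HasSum (fun k : ℕ => ((k : ℝ) / m - x) ^ 4 * szaszWeight k m x)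
      (3 * x ^ 2 / m ^ 2 + x / m ^ 3) := by
  have hm' : (m : ℝ) ≠ 0 := by exact_mod_cast hm
  have d (r) := hasSum_descFactorial_mul_szaszWeight r m x
  -- Coefficients of `(k - mx) ^ 4` in the falling factorials of `k`; the constants 1, 6, 7, 1 are
  -- Stirling numbers of the second kind.
  have h := (((((d 4).add ((d 3).mul_left (6 - 4 * (m * x)))).add
    ((d 2).mul_left (7 - 12 * (m * x) + 6 * (m * x) ^ 2))).add
    ((d 1).mul_left (1 - 4 * (m * x) + 6 * (m * x) ^ 2 - 4 * (m * x) ^ 3))).add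
    ((d 0).mul_left ((m * x) ^ 4))).mul_left (((m : ℝ) ^ 4)⁻¹)
  have e : ((m : ℝ) ^ 4)⁻¹ * ((m * x) ^ 4 + (6 - 4 * (m * x)) * (m * x) ^ 3 +
      (7 - 12 * (m * x) + 6 * (m * x) ^ 2) * (m * x) ^ 2 +
      (1 - 4 * (m * x) + 6 * (m * x) ^ 2 - 4 * (m * x) ^ 3) * (m * x) ^ 1 +
      (m * x) ^ 4 * (m * x) ^ 0) = 3 * x ^ 2 / m ^ 2 + x / m ^ 3 := by
    field_simp
    ring
  rw [e] at h
  refine h.congr_fun fun k => ?_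
  simp only [← descPochhammer_eval_eq_descFactorial ℝ]
  simp [descPochhammer_succ_right]
  field_simp
  ring

/-- A bounded function is summable against the Poisson weights. -/
lemma summable_mul_szaszWeight (m : ℕ) {x : ℝ} (hx : 0 ≤ x) {u : ℕ → ℝ} {C : ℝ}
    (hu : ∀ k, |u k| ≤ C) : Summable fun k : ℕ => u k * szaszWeight k m x := by
  refine Summable.of_norm_bounded ((hasSum_szaszWeight m x).summable.mul_left C) fun k => ?_
  rw [Real.norm_eq_abs, abs_mul, abs_of_nonneg (szaszWeight_nonneg k m hx)]
  exact mul_le_mul_of_nonneg_right (hu k) (szaszWeight_nonneg k m hx)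

/-! ### Taylor bounds and the bias -/

/-- Peano form of the second order Taylor formula. -/
lemma exists_taylor_two_bound {F f : ℝ → ℝ} {x f'x : ℝ} (hF : ∀ᶠ y in 𝓝 x, HasDerivAt F (f y) y)
    (hf : HasDerivAt f f'x x) {ε : ℝ} (hε : 0 < ε) :
    ∃ δ > 0, ∀ y, |y - x| < δ →
      |F y - F x - f x * (y - x) - f'x / 2 * (y - x) ^ 2| ≤ ε * (y - x) ^ 2 := by
  have h1 := hf.isLittleO.def hε
  obtain ⟨δ, hδ, hball⟩ := Metric.eventually_nhds_iff.mp (hF.and h1)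
  refine ⟨δ, hδ, fun y hy => ?_⟩
  -- The mean value inequality on this ball turns the first order expansion of `f` into a bound on
  -- the remainder of `F`.
  have key : ∀ z ∈ Metric.closedBall x |y - x|,
      HasDerivWithinAt (fun z => F z - F x - f x * (z - x) - f'x / 2 * (z - x) ^ 2)
        (f z - f x - f'x * (z - x)) (Metric.closedBall x |y - x|) z := by
    intro z hz
    have hd := (hball (lt_of_le_of_lt hz hy)).1
    have h2 := (hasDerivAt_id z).sub_const x
    have := ((hd.sub_const (F x)).sub (h2.const_mul (f x))).sub ((h2.pow 2).const_mul (f'x / 2))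
    refine (this.congr_deriv ?_).hasDerivWithinAt
    simp
    ring
  have bound : ∀ z ∈ Metric.closedBall x |y - x|,
      ‖f z - f x - f'x * (z - x)‖ ≤ ε * |y - x| := by
    intro z hz
    have := (hball (lt_of_le_of_lt hz hy)).2
    have hz' : |z - x| ≤ |y - x| := hz
    simp only [smul_eq_mul, Real.norm_eq_abs] at this ⊢
    rw [mul_comm f'x]
    exact this.trans (mul_le_mul_of_nonneg_left hz' hε.le)
  have := (convex_closedBall x |y - x|).norm_image_sub_le_of_norm_hasDerivWithin_le key bound
    (x := x) (y := y) (by simp) (by simp [Real.dist_eq])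
  simp only [Real.norm_eq_abs] at this
  have e : ε * (y - x) ^ 2 = ε * |y - x| * |y - x| := by
    rw [← sq_abs (y - x), sq, mul_assoc]
  rw [e]
  simpa using this

/-- Taylor bound for a bounded function, with a quartic term absorbing the points far from `x`. -/
lemma exists_taylor_two_global_bound {F f : ℝ → ℝ} {x f'x C : ℝ} (hFb : ∀ y, |F y| ≤ C)
    (hF : ∀ᶠ y in 𝓝 x, HasDerivAt F (f y) y)
    (hf : HasDerivAt f f'x x) {ε : ℝ} (hε : 0 < ε) :
    ∃ K, 0 ≤ K ∧ ∀ y,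
      |F y - F x - f x * (y - x) - f'x / 2 * (y - x) ^ 2| ≤
        ε * (y - x) ^ 2 + K * (y - x) ^ 4 := by
  obtain ⟨δ, hδ, h⟩ := exists_taylor_two_bound hF hf hε
  have hC : 0 ≤ C := (abs_nonneg _).trans (hFb 0)
  -- Far from `x`, `|y - x| ^ j ≤ |y - x| ^ 4 / δ ^ (4 - j)`; the summands of `K` are the cases `j =
  -- 0, 1, 2`.
  refine ⟨2 * C / δ ^ 4 + |f x| / δ ^ 3 + |f'x / 2| / δ ^ 2, by positivity, fun y => ?_⟩
  rcases lt_or_ge |y - x| δ with hy | hy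
  · exact (h y hy).trans (le_add_of_nonneg_right (by positivity))
  · have q (j : ℕ) (hj : j ≤ 4) : |y - x| ^ j ≤ |y - x| ^ 4 / δ ^ (4 - j) := by
      rw [le_div_iff₀ (by positivity)]
      calc |y - x| ^ j * δ ^ (4 - j) ≤ |y - x| ^ j * |y - x| ^ (4 - j) := by gcongr
        _ = |y - x| ^ 4 := by rw [← pow_add]; congr 1; omega
    have q0 := q 0 (by norm_num)
    have q1 := q 1 (by norm_num)
    have q2 := q 2 (by norm_num)
    have e4 : (y - x) ^ 4 = |y - x| ^ 4 := (Even.pow_abs (by decide) _).symm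
    have e2 : (y - x) ^ 2 = |y - x| ^ 2 := (sq_abs _).symm
    calc |F y - F x - f x * (y - x) - f'x / 2 * (y - x) ^ 2|
        ≤ |F y| + |F x| + |f x * (y - x)| + |f'x / 2 * (y - x) ^ 2| := by
          refine (abs_sub _ _).trans (add_le_add_left ((abs_sub _ _).trans
            (add_le_add_left (abs_sub _ _) _)) _)
      _ ≤ 2 * C * |y - x| ^ 0 + |f x| * |y - x| ^ 1 + |f'x / 2| * |y - x| ^ 2 := by
          rw [abs_mul, abs_mul, abs_pow]
          have := hFb x
          have := hFb y
          simp only [pow_zero, pow_one, mul_one]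
          gcongr
          linarith
      _ ≤ 2 * C * (|y - x| ^ 4 / δ ^ (4 - 0)) + |f x| * (|y - x| ^ 4 / δ ^ (4 - 1))
          + |f'x / 2| * (|y - x| ^ 4 / δ ^ (4 - 2)) := by gcongr
      _ = (2 * C / δ ^ 4 + |f x| / δ ^ 3 + |f'x / 2| / δ ^ 2) * (y - x) ^ 4 := by
          rw [e4]; ring
      _ ≤ _ := le_add_of_nonneg_left (by positivity)

/-- Voronovskaya's theorem for the Szasz-Mirakyan operator and bounded functions. -/
lemma tendsto_mul_szaszOperator_sub {F f : ℝ → ℝ} {x f'x C : ℝ} (hx : 0 ≤ x)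
    (hFb : ∀ y, |F y| ≤ C) (hF : ∀ᶠ y in 𝓝 x, HasDerivAt F (f y) y) (hf : HasDerivAt f f'x x) :
    Tendsto (fun m : ℕ => (m : ℝ) * (szaszOperator m F x - F x)) atTop (𝓝 (x * f'x / 2)) := by
  rw [Metric.tendsto_atTop']
  intro η hη
  -- After multiplication by `m`, the quadratic term contributes `ε x ≤ η / 2`; the quartic one is
  -- `O(1 / m)`.
  obtain ⟨K, hK, hb⟩ := exists_taylor_two_global_bound hFb hF hf
    (ε := η / (2 * (x + 1))) (by positivity)
  have lim : Tendsto (fun m : ℕ => K * (3 * x ^ 2 * (1 / (m : ℝ)) + x * (1 / (m : ℝ)) ^ 2))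
      atTop (𝓝 (K * (3 * x ^ 2 * 0 + x * 0 ^ 2))) :=
    (((tendsto_one_div_atTop_nhds_zero_nat (𝕜 := ℝ)).const_mul _).add
      (((tendsto_one_div_atTop_nhds_zero_nat (𝕜 := ℝ)).pow 2).const_mul _)).const_mul K
  obtain ⟨N, hN⟩ := eventually_atTop.mp
    (lim.eventually_lt_const (u := η / 2) (by simpa using hη))
  refine ⟨N, fun m hm => ?_⟩
  have hm0 : m ≠ 0 := by omega
  have hmpos : (0 : ℝ) < m := by exact_mod_cast Nat.pos_of_ne_zero hm0
  have s0 := (summable_mul_szaszWeight m hx (u := fun k : ℕ => F (k / m))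
    (fun k => hFb _)).hasSum
  have s := ((s0.sub ((hasSum_szaszWeight m x).mul_left (F x))).sub
    ((hasSum_szaszWeight_centered hm0 x).mul_left (f x))).sub
    ((hasSum_szaszWeight_sq hm0 x).mul_left (f'x / 2))
  have b := ((hasSum_szaszWeight_sq hm0 x).mul_left (η / (2 * (x + 1)))).add
    ((hasSum_szaszWeight_pow_four hm0 x).mul_left K)
  have hle : |szaszOperator m F x - F x - f'x / 2 * (x / m)| ≤
      η / (2 * (x + 1)) * (x / m) + K * (3 * x ^ 2 / m ^ 2 + x / m ^ 3) := by
    have := s.norm_le_of_bounded b fun k => by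
      have h1 := mul_le_mul_of_nonneg_right (hb (k / m)) (szaszWeight_nonneg k m hx)
      rw [← abs_of_nonneg (szaszWeight_nonneg k m hx), ← abs_mul,
        abs_of_nonneg (szaszWeight_nonneg k m hx)] at h1
      rw [Real.norm_eq_abs]
      convert! h1 using 1
      · congr 1
        ring
      · ring
    simpa [szaszOperator] using this
  rw [Real.dist_eq]
  calc |(m : ℝ) * (szaszOperator m F x - F x) - x * f'x / 2|
      = m * |szaszOperator m F x - F x - f'x / 2 * (x / m)| := by
        rw [← abs_of_pos hmpos, ← abs_mul, abs_of_pos hmpos]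
        congr 1
        field_simp
    _ ≤ m * (η / (2 * (x + 1)) * (x / m) + K * (3 * x ^ 2 / m ^ 2 + x / m ^ 3)) := by gcongr
    _ = η / 2 * (x / (x + 1)) + K * (3 * x ^ 2 * (1 / (m : ℝ)) + x * (1 / (m : ℝ)) ^ 2) := by
        field_simp
    _ < η := by
        have h1 := hN m hm.le
        have h2 : x / (x + 1) ≤ 1 := by rw [div_le_one (by positivity)]; linarith
        nlinarith

/-! ### The kernel of a single observation -/

/-- The contribution `S_m(𝕀(t ≤ ·); x)` of an observation `t` to the Szasz estimator. -/
noncomputable def szaszKernel (m : ℕ) (x t : ℝ) : ℝ :=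
  szaszOperator m (Set.indicator (Set.Ici t) fun _ => 1) x

lemma abs_indicator_one_le_one {α : Type*} (s : Set α) (a : α) :
    |s.indicator (fun _ => (1 : ℝ)) a| ≤ 1 := by
  by_cases h : a ∈ s <;> simp [h]

lemma hasSum_szaszKernel (m : ℕ) {x : ℝ} (hx : 0 ≤ x) (t : ℝ) :
    HasSum (fun k : ℕ => (Set.Ici t).indicator (fun _ => (1 : ℝ)) ((k : ℝ) / m) *
      szaszWeight k m x) (szaszKernel m x t) :=
  (summable_mul_szaszWeight m hx fun k =>
    abs_indicator_one_le_one (Set.Ici t) ((k : ℝ) / m)).hasSum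

lemma szaszKernel_nonneg (m : ℕ) {x : ℝ} (hx : 0 ≤ x) (t : ℝ) : 0 ≤ szaszKernel m x t :=
  (hasSum_szaszKernel m hx t).nonneg fun k =>
    mul_nonneg (Set.indicator_nonneg (fun _ _ => zero_le_one) _) (szaszWeight_nonneg k m hx)

lemma szaszKernel_le_one (m : ℕ) {x : ℝ} (hx : 0 ≤ x) (t : ℝ) : szaszKernel m x t ≤ 1 :=
  hasSum_le (fun k => mul_le_of_le_one_left (szaszWeight_nonneg k m hx)
      ((le_abs_self _).trans (abs_indicator_one_le_one _ _)))
    (hasSum_szaszKernel m hx t) (hasSum_szaszWeight m x)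

/-- Monotonicity supplies the measurability of the kernel. -/
lemma antitone_szaszKernel (m : ℕ) {x : ℝ} (hx : 0 ≤ x) : Antitone (szaszKernel m x) := by
  intro s t hst
  refine hasSum_le (fun k => mul_le_mul_of_nonneg_right ?_ (szaszWeight_nonneg k m hx))
    (hasSum_szaszKernel m hx t) (hasSum_szaszKernel m hx s)
  exact Set.indicator_le_indicator_of_subset (Set.Ici_subset_Ici.mpr hst)
    (fun _ => zero_le_one) _

/-- Chebyshev's argument: the two indicators differ only if `t` separates `k / m` from `x`, which
forces `|k / m - x| ≥ |t - x|`. -/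
lemma abs_szaszKernel_sub_indicator_le {m : ℕ} (hm : m ≠ 0) {x t : ℝ} (hx : 0 ≤ x)
    (ht : t ≠ x) :
    |szaszKernel m x t - (Set.Iic x).indicator (fun _ => (1 : ℝ)) t| ≤
      x / (t - x) ^ 2 * (1 / m) := by
  have hpos : 0 < (t - x) ^ 2 := by
    have := sub_ne_zero.mpr ht
    positivity
  have s := (hasSum_szaszKernel m hx t).sub
    ((hasSum_szaszWeight m x).mul_left ((Set.Iic x).indicator (fun _ => (1 : ℝ)) t))
  have b := (hasSum_szaszWeight_sq hm x).mul_left (((t - x) ^ 2)⁻¹)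
  have := s.norm_le_of_bounded b fun k => by
    have hW := szaszWeight_nonneg k m hx
    rw [← sub_mul, norm_mul, Real.norm_of_nonneg hW, ← mul_assoc]
    refine mul_le_mul_of_nonneg_right ?_ hW
    rw [inv_mul_eq_div]
    have far (h : (t - x) ^ 2 ≤ ((k : ℝ) / m - x) ^ 2) :
        1 ≤ ((k : ℝ) / m - x) ^ 2 / (t - x) ^ 2 := (one_le_div hpos).mpr h
    have hnn : 0 ≤ ((k : ℝ) / m - x) ^ 2 / (t - x) ^ 2 := by positivity
    by_cases h1 : t ≤ (k : ℝ) / m <;> by_cases h2 : t ≤ x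
    · simpa [h1, h2] using hnn
    · simpa [h1, h2] using far (by nlinarith)
    · simpa [h1, h2] using far (by nlinarith)
    · simpa [h1, h2] using hnn
  rw [Real.norm_eq_abs, mul_one] at this
  refine this.trans_eq ?_
  ring

lemma tendsto_szaszKernel {x t : ℝ} (hx : 0 ≤ x) (ht : t ≠ x) :
    Tendsto (fun m : ℕ => szaszKernel m x t) atTop
      (𝓝 ((Set.Iic x).indicator (fun _ => (1 : ℝ)) t)) := by
  rw [tendsto_iff_dist_tendsto_zero]
  have lim := (tendsto_one_div_atTop_nhds_zero_nat (𝕜 := ℝ)).const_mul (x / (t - x) ^ 2)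
  rw [mul_zero] at lim
  refine squeeze_zero' (.of_forall fun _ => dist_nonneg) ?_ lim
  filter_upwards [eventually_ne_atTop 0] with m hm
  exact abs_szaszKernel_sub_indicator_le hm hx ht

lemma szaszEstimator_eq_sum_szaszKernel {Ω : Type*} (X : ℕ → Ω → ℝ) (m n : ℕ) {x : ℝ}
    (hx : 0 ≤ x) (ω : Ω) :
    szaszEstimator X m n x ω =
      (n : ℝ)⁻¹ * ∑ i ∈ Finset.range n, szaszKernel m x (X i ω) := by
  have h := (hasSum_sum fun i (_ : i ∈ Finset.range n) =>
    hasSum_szaszKernel m hx (X i ω)).mul_left ((n : ℝ)⁻¹)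
  rw [← h.tsum_eq]
  refine tsum_congr fun k => ?_
  rw [edf, ← Finset.sum_mul, mul_assoc]
  rfl

/-- Sum and integral are exchanged, so the mean of the kernel carries the whole bias. -/
lemma integral_szaszKernel (P : Measure ℝ) [IsProbabilityMeasure P] (m : ℕ) {x : ℝ}
    (hx : 0 ≤ x) : ∫ t, szaszKernel m x t ∂P = szaszOperator m (cdf P) x := by
  have e (k : ℕ) (t : ℝ) : (Set.Ici t).indicator (fun _ => (1 : ℝ)) ((k : ℝ) / m) *
      szaszWeight k m x = (Set.Iic ((k : ℝ) / m)).indicator (fun _ => szaszWeight k m x) t := by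
    by_cases h : t ≤ (k : ℝ) / m <;> simp [h]
  have i (k : ℕ) : ∫ t, (Set.Iic ((k : ℝ) / m)).indicator (fun _ => szaszWeight k m x) t ∂P =
      cdf P (k / m) * szaszWeight k m x := by
    rw [integral_indicator_const _ measurableSet_Iic, cdf_eq_real, smul_eq_mul]
  have h := integral_tsum_of_summable_integral_norm (μ := P)
    (F := fun (k : ℕ) t => (Set.Iic ((k : ℝ) / m)).indicator (fun _ => szaszWeight k m x) t)
    (fun k => (integrable_const _).indicator measurableSet_Iic) ?_
  · simp only [szaszKernel, szaszOperator, e]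
    rw [← h]
    exact tsum_congr i
  · have : ∀ (k : ℕ) (t : ℝ),
        ‖(Set.Iic ((k : ℝ) / m)).indicator (fun _ => szaszWeight k m x) t‖ =
          (Set.Iic ((k : ℝ) / m)).indicator (fun _ => szaszWeight k m x) t := fun k t =>
      Real.norm_of_nonneg (Set.indicator_nonneg (fun _ _ => szaszWeight_nonneg k m hx) _)
    simp only [this, i]
    refine summable_mul_szaszWeight m hx (C := 1) fun k => ?_
    rw [abs_of_nonneg (cdf_nonneg P _)]
    exact cdf_le_one P _

/-! ### Limit theorems -/

section Probability

variable {Ω : Type*} [MeasurableSpace Ω] {μ : Measure Ω} [IsProbabilityMeasure μ]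
  {P : Measure ℝ} {X : ℕ → Ω → ℝ}

/-- Normalized centered sums of a triangular array of bounded functions of an i.i.d. sequence
tend to zero in probability when the second moments tend to zero. -/
lemma tendstoInMeasure_inv_sqrt_mul_sum_sub (hlaw : ∀ i, HasLaw (X i) P μ)
    (hindep : iIndepFun X μ) {D : ℕ → ℝ → ℝ} (hD : ∀ n, Measurable (D n)) {C : ℝ}
    (hDb : ∀ n t, |D n t| ≤ C) (hlim : Tendsto (fun n => ∫ t, D n t ^ 2 ∂P) atTop (𝓝 0)) :
    TendstoInMeasure μ (fun (n : ℕ) ω =>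
      (√(n : ℝ))⁻¹ * (∑ i ∈ Finset.range n, D n (X i ω) - n * ∫ t, D n t ∂P)) atTop
      (fun _ => 0) := by
  have hX i := (hlaw i).aemeasurable
  have hDX n i : AEMeasurable (fun ω => D n (X i ω)) μ := (hD n).comp_aemeasurable (hX i)
  have hLp n i : MemLp (fun ω => D n (X i ω)) 2 μ :=
    MemLp.of_bound (hDX n i).aestronglyMeasurable C (.of_forall fun ω => hDb n _)
  have hint n i : ∫ ω, D n (X i ω) ∂μ = ∫ t, D n t ∂P :=
    (hlaw i).integral_comp (hD n).aestronglyMeasurable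
  have hvar n i : Var[fun ω => D n (X i ω); μ] ≤ ∫ t, D n t ^ 2 ∂P := by
    refine (variance_le_expectation_sq (hDX n i).aestronglyMeasurable).trans_eq ?_
    exact (hlaw i).integral_comp ((hD n).pow_const 2).aestronglyMeasurable
  set U : ℕ → Ω → ℝ := fun n ω => (√(n : ℝ))⁻¹ * ∑ i ∈ Finset.range n, D n (X i ω) with hU
  have hULp n : MemLp (U n) 2 μ := (memLp_finsetSum _ fun i _ => hLp n i).const_mul _
  have hUint n : ∫ ω, U n ω ∂μ = (√(n : ℝ))⁻¹ * (n * ∫ t, D n t ∂P) := by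
    simp only [hU]
    rw [integral_const_mul, integral_finsetSum _ fun i _ => (hLp n i).integrable (by norm_num)]
    simp [hint]
  have hUvar n : Var[U n; μ] ≤ ∫ t, D n t ^ 2 ∂P := by
    have hs : Var[fun ω => ∑ i ∈ Finset.range n, D n (X i ω); μ] =
        ∑ i ∈ Finset.range n, Var[fun ω => D n (X i ω); μ] := by
      rw [← IndepFun.variance_sum (fun i _ => hLp n i) fun i _ j _ hij =>
        (hindep.indepFun hij).comp (hD n) (hD n)]
      congr 1
      ext ω
      simp
    have hnn : 0 ≤ ∫ t, D n t ^ 2 ∂P := integral_nonneg fun _ => sq_nonneg _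
    simp only [hU]
    rw [variance_const_mul, hs, inv_pow, Real.sq_sqrt (Nat.cast_nonneg n)]
    calc (n : ℝ)⁻¹ * ∑ i ∈ Finset.range n, Var[fun ω => D n (X i ω); μ]
        ≤ (n : ℝ)⁻¹ * ∑ i ∈ Finset.range n, ∫ t, D n t ^ 2 ∂P := by
          gcongr with i
          exact hvar n i
      _ = ((n : ℝ)⁻¹ * n) * ∫ t, D n t ^ 2 ∂P := by simp [mul_assoc]
      _ ≤ 1 * ∫ t, D n t ^ 2 ∂P := by
          gcongr
          exact inv_mul_le_one
      _ = _ := one_mul _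
  rw [tendstoInMeasure_iff_norm]
  intro ε hε
  have lim : Tendsto (fun n => ENNReal.ofReal ((∫ t, D n t ^ 2 ∂P) / ε ^ 2)) atTop (𝓝 0) := by
    simpa using ENNReal.tendsto_ofReal (hlim.div_const (ε ^ 2))
  refine tendsto_of_tendsto_of_tendsto_of_le_of_le tendsto_const_nhds lim
    (fun _ => zero_le) fun n => ?_
  refine le_trans (le_of_eq ?_) ((meas_ge_le_variance_div_sq (hULp n) hε).trans
    (ENNReal.ofReal_le_ofReal (by gcongr; exact hUvar n)))
  rw [hUint]
  simp only [hU, mul_sub, sub_zero, Real.norm_eq_abs]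

/-- Central limit theorem for the empirical distribution function at a point, with the limit
realized as a shifted Gaussian variable. -/
lemma tendstoInDistribution_edf [IsProbabilityMeasure P]
    (hlaw : ∀ i, HasLaw (X i) P μ) (hindep : iIndepFun X μ) (x b : ℝ) :
    TendstoInDistribution
      (fun (n : ℕ) ω => (√(n : ℝ))⁻¹ *
        (∑ i ∈ Finset.range n, (Set.Iic x).indicator (fun _ => (1 : ℝ)) (X i ω) - n * cdf P x))
      atTop (fun y : ℝ => y - b) (fun _ => μ)
      (gaussianReal b (Real.toNNReal (cdf P x * (1 - cdf P x)))) := by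
  have hI : Measurable ((Set.Iic x).indicator fun _ => (1 : ℝ)) :=
    measurable_const.indicator measurableSet_Iic
  have hZ i : AEMeasurable (fun ω => (Set.Iic x).indicator (fun _ => (1 : ℝ)) (X i ω)) μ :=
    hI.comp_aemeasurable (hlaw i).aemeasurable
  have hLp : MemLp (fun ω => (Set.Iic x).indicator (fun _ => (1 : ℝ)) (X 0 ω)) 2 μ :=
    MemLp.of_bound (hZ 0).aestronglyMeasurable 1 (.of_forall fun ω => abs_indicator_one_le_one _ _)
  have hP : ∫ t, (Set.Iic x).indicator (fun _ => (1 : ℝ)) t ∂P = cdf P x := by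
    rw [integral_indicator_const _ measurableSet_Iic, cdf_eq_real, smul_eq_mul, mul_one]
  have hmean : ∫ ω, (Set.Iic x).indicator (fun _ => (1 : ℝ)) (X 0 ω) ∂μ = cdf P x :=
    ((hlaw 0).integral_comp hI.aestronglyMeasurable).trans hP
  have hvar : Var[fun ω => (Set.Iic x).indicator (fun _ => (1 : ℝ)) (X 0 ω); μ] =
      cdf P x * (1 - cdf P x) := by
    have hsq : (fun ω => (Set.Iic x).indicator (fun _ => (1 : ℝ)) (X 0 ω)) ^ 2 =
        fun ω => (Set.Iic x).indicator (fun _ => (1 : ℝ)) (X 0 ω) := by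
      ext ω
      by_cases h : X 0 ω ≤ x <;> simp [h]
    rw [variance_eq_sub hLp, hsq, hmean]
    ring
  have h := tendstoInDistribution_inv_sqrt_mul_sum_sub (P := μ)
    (P' := gaussianReal b (Real.toNNReal (cdf P x * (1 - cdf P x))))
    (X := fun i ω => (Set.Iic x).indicator (fun _ => (1 : ℝ)) (X i ω))
    (Y := fun y : ℝ => y - b) ?_ hLp (hindep.comp _ fun _ => hI)
    fun i => ((hlaw i).identDistrib (hlaw 0)).comp hI
  · rwa [hmean] at h
  · rw [hvar]
    simpa using gaussianReal_sub_const (HasLaw.id (μ := gaussianReal b _)) b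

/-- Asymptotic normality of the Szasz estimator when the scaled bias converges. -/
lemma tendstoInDistribution_szaszEstimator [IsProbabilityMeasure P]
    (hlaw : ∀ i, HasLaw (X i) P μ)
    (hindep : iIndepFun X μ) {m : ℕ → ℕ} (hm : Tendsto m atTop atTop) {x : ℝ} (hx : 0 ≤ x)
    (hPx : P {x} = 0) {b : ℝ}
    (hb : Tendsto (fun n : ℕ => √(n : ℝ) * (szaszOperator (m n) (cdf P) x - cdf P x))
      atTop (𝓝 b)) :
    TendstoInDistribution
      (fun (n : ℕ) (ω : Ω) => √(n : ℝ) * (szaszEstimator X (m n) n x ω - cdf P x))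
      atTop (id : ℝ → ℝ) (fun _ => μ)
      (gaussianReal b (Real.toNNReal (cdf P x * (1 - cdf P x)))) := by
  have hI : Measurable ((Set.Iic x).indicator fun _ => (1 : ℝ)) :=
    measurable_const.indicator measurableSet_Iic
  have hK n : Measurable (szaszKernel (m n) x) := (antitone_szaszKernel (m n) hx).measurable
  set D : ℕ → ℝ → ℝ := fun n t =>
    szaszKernel (m n) x t - (Set.Iic x).indicator (fun _ => (1 : ℝ)) t with hDdef
  have hD n : Measurable (D n) := (hK n).sub hI
  have hKb n t : |szaszKernel (m n) x t| ≤ 1 :=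
    (abs_of_nonneg (szaszKernel_nonneg (m n) hx t)).trans_le (szaszKernel_le_one (m n) hx t)
  have hDb n t : |D n t| ≤ 2 := (abs_sub _ _).trans
    ((add_le_add (hKb n t) (abs_indicator_one_le_one _ _)).trans_eq (by norm_num))
  have hDint n : ∫ t, D n t ∂P = szaszOperator (m n) (cdf P) x - cdf P x := by
    simp only [hDdef]
    rw [integral_sub (.of_bound (hK n).aestronglyMeasurable 1 (.of_forall (hKb n)))
      ((integrable_const _).indicator measurableSet_Iic), integral_szaszKernel P _ hx,
      integral_indicator_const _ measurableSet_Iic, cdf_eq_real, smul_eq_mul, mul_one]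
  have hlim : Tendsto (fun n => ∫ t, D n t ^ 2 ∂P) atTop (𝓝 0) := by
    rw [← integral_zero ℝ ℝ (μ := P)]
    refine tendsto_integral_filter_of_dominated_convergence (fun _ => 4)
      (.of_forall fun n => ((hD n).pow_const 2).aestronglyMeasurable)
      (.of_forall fun n => .of_forall fun t => ?_) (integrable_const _) ?_
    · rw [norm_pow, Real.norm_eq_abs]
      nlinarith [hDb n t, abs_nonneg (D n t)]
    · have hae : ∀ᵐ t ∂P, t ≠ x := by simpa [ae_iff] using hPx
      filter_upwards [hae] with t ht
      have := (((tendsto_szaszKernel hx ht).comp hm).sub_const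
        ((Set.Iic x).indicator (fun _ => (1 : ℝ)) t)).pow 2
      simpa [hDdef, Function.comp_def] using this
  -- The limit is realized as `y - b` under a Gaussian law of mean `b`, so that adding the bias
  -- limit `b` leaves `id`.
  have hA := tendstoInDistribution_edf hlaw hindep x b
  have hB := tendstoInMeasure_inv_sqrt_mul_sum_sub hlaw hindep hD hDb hlim
  have hBm (n : ℕ) : AEMeasurable (fun ω => (√(n : ℝ))⁻¹ *
      (∑ i ∈ Finset.range n, D n (X i ω) - n * ∫ t, D n t ∂P)) μ :=
    ((Finset.aemeasurable_fun_sum _ fun i _ =>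
      (hD n).comp_aemeasurable (hlaw i).aemeasurable).sub_const _).const_mul _
  have hbm : TendstoInMeasure μ
      (fun (n : ℕ) (_ : Ω) => √(n : ℝ) * (szaszOperator (m n) (cdf P) x - cdf P x)) atTop
      (fun _ => b) :=
    tendstoInMeasure_of_tendsto_ae (fun _ => aestronglyMeasurable_const) (.of_forall fun _ => hb)
  have h := (hA.add_of_tendstoInMeasure_const hB hBm).add_of_tendstoInMeasure_const hbm
    fun _ => aemeasurable_const
  convert! h using 1
  · ext n ω
    rcases Nat.eq_zero_or_pos n with rfl | hn
    · simp
    have hn' : (0 : ℝ) < n := by exact_mod_cast hn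
    have hs : √(n : ℝ) * √(n : ℝ) = n := Real.mul_self_sqrt hn'.le
    have hs0 : √(n : ℝ) ≠ 0 := (Real.sqrt_pos.mpr hn').ne'
    simp only [Pi.add_apply, hDint]
    simp only [hDdef, Finset.sum_sub_distrib,
      szaszEstimator_eq_sum_szaszKernel X (m n) n hx ω]
    have hinv : (n : ℝ)⁻¹ = (√(n : ℝ))⁻¹ * (√(n : ℝ))⁻¹ := by rw [← mul_inv, hs]
    have hn1 : (n : ℝ) = √(n : ℝ) * √(n : ℝ) := hs.symm
    rw [hinv]
    generalize √(n : ℝ) = r at *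
    rw [hn1]
    field_simp
    ring
  · ext y
    simp

end Probability

theorem mainTheorem6
    {Ω : Type*} [MeasurableSpace Ω] (μ : Measure Ω) [IsProbabilityMeasure μ]
    -- the common law `P` of the observations, a probability measure on `[0, ∞)`
    (P : Measure ℝ) [IsProbabilityMeasure P] (hP : P (Set.Iio 0) = 0)
    -- the observations: independent and distributed according to `P`
    (X : ℕ → Ω → ℝ) (hlaw : ∀ i, HasLaw (X i) P μ) (hindep : iIndepFun X μ)
    -- `F = cdf P` is continuous, with first and second derivatives `f`, `f'` on `[0, ∞)`
    -- (one-sided at `0`) that are continuous and bounded there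
    (hF : Continuous (cdf P))
    (f f' : ℝ → ℝ)
    (hf : ∀ t ∈ Set.Ici (0 : ℝ), HasDerivWithinAt (cdf P) (f t) (Set.Ici 0) t)
    (hf' : ∀ t ∈ Set.Ici (0 : ℝ), HasDerivWithinAt f (f' t) (Set.Ici 0) t)
    (hf_cont : ContinuousOn f (Set.Ici 0))
    (hf'_cont : ContinuousOn f' (Set.Ici 0))
    (hf_bdd : ∃ C : ℝ, ∀ t ∈ Set.Ici (0 : ℝ), |f t| ≤ C)
    (hf'_bdd : ∃ C : ℝ, ∀ t ∈ Set.Ici (0 : ℝ), |f' t| ≤ C)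
    -- the smoothing parameters `m = m n`
    (m : ℕ → ℕ) (hm : Tendsto m atTop atTop)
    (x : ℝ) (hx : 0 < x) (hFx0 : 0 < cdf P x) (hFx1 : cdf P x < 1) :
    (Tendsto (fun n : ℕ => (m n : ℝ) / √(n : ℝ)) atTop atTop →
      TendstoInDistribution
        (fun (n : ℕ) (ω : Ω) => √(n : ℝ) * (szaszEstimator X (m n) n x ω - cdf P x))
        atTop (id : ℝ → ℝ) (fun _ => μ)
        (gaussianReal 0 (Real.toNNReal (cdf P x * (1 - cdf P x))))) ∧
    (∀ c : ℝ, 0 < c →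
      Tendsto (fun n : ℕ => (m n : ℝ) / √(n : ℝ)) atTop (𝓝 c) →
      TendstoInDistribution
        (fun (n : ℕ) (ω : Ω) => √(n : ℝ) * (szaszEstimator X (m n) n x ω - cdf P x))
        atTop (id : ℝ → ℝ) (fun _ => μ)
        (gaussianReal (c⁻¹ * (x * f' x / 2))
          (Real.toNNReal (cdf P x * (1 - cdf P x))))) := by
  have hFx : HasDerivAt f (f' x) x := (hf' x hx.le).hasDerivAt (Ici_mem_nhds hx)
  have hFnear : ∀ᶠ y in 𝓝 x, HasDerivAt (cdf P) (f y) y := by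
    filter_upwards [Ioi_mem_nhds hx] with y hy
    exact (hf y (Set.Ioi_subset_Ici_self hy)).hasDerivAt (Ici_mem_nhds hy)
  have hFb : ∀ y, |cdf P y| ≤ 1 := fun y =>
    (abs_of_nonneg (cdf_nonneg P y)).trans_le (cdf_le_one P y)
  -- The mass at `x` is the jump of the continuous `F` there.
  have hPx : P {x} = 0 := by
    rw [← measure_cdf P, StieltjesFunction.measure_singleton,
      hF.continuousAt.continuousWithinAt.leftLim_eq, sub_self, ENNReal.ofReal_zero]
  have hV := (tendsto_mul_szaszOperator_sub hx.le hFb hFnear hFx).comp hm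
  have key {a : ℝ} (ha : Tendsto (fun n : ℕ => ((m n : ℝ) / √(n : ℝ))⁻¹) atTop (𝓝 a)) :
      Tendsto (fun n : ℕ => √(n : ℝ) * (szaszOperator (m n) (cdf P) x - cdf P x)) atTop
        (𝓝 (a * (x * f' x / 2))) := by
    refine (ha.mul hV).congr' ?_
    filter_upwards [hm.eventually_ne_atTop 0] with n hn
    have : (m n : ℝ) ≠ 0 := by exact_mod_cast hn
    simp only [Function.comp_apply, inv_div]
    field_simp
  refine ⟨fun h => ?_, fun c hc h => ?_⟩
  · have := key h.inv_tendsto_atTop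
    rw [zero_mul] at this
    exact tendstoInDistribution_szaszEstimator hlaw hindep hm hx.le hPx this
  · exact tendstoInDistribution_szaszEstimator hlaw hindep hm hx.le hPx (key (h.inv₀ hc.ne'))
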